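/- Let $d\in\mathbb N$. Nets are indexed by $\varepsilon\in(0,1]$, and "for small $\varepsilon$" means for all $\varepsilon\in(0,\eta)\cap(0,1]$, for some $\eta>0$. For a normed space $V$, let $\widetilde V$ be the group of nets $(x_\varepsilon)_\varepsilon$ in $V$ such that, for some $N\in\mathbb N$, $|x_\varepsilon|\le\varepsilon^{-N}$ for small $\varepsilon$, modulo those nets with $|x_\varepsilon|\le\varepsilon^{m}$ for small $\varepsilon$, for every $m\in\mathbb N$. This gives the generalized constants $\widetilde{\mathbb C}$ and the generalized points $\widetilde{\mathbb R}^d$. A point $\xi=[(\xi_\varepsilon)_\varepsilon]\in\widetilde{\mathbb R}^d$ is of slow scale if for each real $a>0$, $|\xi_\varepsilon|\le\varepsilon^{-a}$ for small $\varepsilon$; the set of these points is denoted by $\widetilde{\mathbb R}^d_{ss}$. Let $\mathcal G(\mathbb R^d)=\mathcal M/\mathcal N$ be the special Colombeau algebra, where $\mathcal M$ consists of the nets $(u_\varepsilon)_\varepsilon$ in $C^\infty(\mathbb R^d;\mathbb C)$ such that for each compact $K\subset\mathbb R^d$ and each $\alpha\in\mathbb N^d$ there is $N\in\mathbb N$ with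 $\sup_{x\in K}|\partial^\alpha u_\varepsilon(x)|\le\varepsilon^{-N}$ for small $\varepsilon$, and $\mathcal N$ of those such that for each compact $K$, each $\alpha\in\mathbb N^d$ and each $m\in\mathbb N$, $\sup_{x\in K}|\partial^\alpha u_\varepsilon(x)|\le\varepsilon^{m}$ for small $\varepsilon$. The smooth compactly supported functions $\mathcal D(\mathbb R^d)$ are embedded in $\mathcal G(\mathbb R^d)$ as constant nets. Further: - $\mathcal G_c(\mathbb R^d)$ is the set of those $u\in\mathcal G(\mathbb R^d)$ that have a representative $(u_\varepsilon)_\varepsilon$ with $\operatorname{supp}u_\varepsilon\subseteq K$ for all $\varepsilon$, for some compact $K\subset\mathbb R^d$; - $\mathcal G^\infty(\mathbb R^d)$ is the set of those $u\in\mathcal G(\mathbb R^d)$ that have a representative such that for each compact $K\subset\mathbb R^d$ there is $N\in\mathbb N$ such that for each $\alpha\in\mathbb N^d$, $\sup_{x\in K}|\partial^\alpha u_\varepsilon(x)|\le\varepsilon^{-N}$ for small $\varepsilon$; - $\mathcal G_c^\infty(\mathbb R^d)=\mathcal G^\infty(\mathbb R^d)\cap\mathcal G_c(\mathbb R^d)$.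 For $f\in\mathcal G_c(\mathbb R^d)$ with representative $(f_\varepsilon)_\varepsilon$ supported in one compact set, put $\int_{\mathbb R^d} f=[(\int_{\mathbb R^d} f_\varepsilon)_\varepsilon]\in\widetilde{\mathbb C}$ and, for $\xi=[(\xi_\varepsilon)_\varepsilon]\in\widetilde{\mathbb R}^d$, $\widehat f(\xi)=[(\int_{\mathbb R^d} f_\varepsilon(x)e^{-i\xi_\varepsilon\cdot x}\,dx)_\varepsilon]\in\widetilde{\mathbb C}$; these do not depend on the representatives. **Theorem.** Let $f\in\mathcal G_c(\mathbb R^d)$. The following are equivalent: 1. $\int_{\mathbb R^d}f\phi=0$ in $\widetilde{\mathbb C}$ for all $\phi\in\mathcal D(\mathbb R^d)$; 2. $\int_{\mathbb R^d}f\phi=0$ in $\widetilde{\mathbb C}$ for all $\phi\in\mathcal G_c^\infty(\mathbb R^d)$; 3. $\widehat f(\xi)=0$ in $\widetilde{\mathbb C}$ for all $\xi\in\widetilde{\mathbb R}^d_{ss}$. -/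

import Mathlib

open scoped ContDiff Distributions

noncomputable section

namespace Colombeau

/-- The index set `(0, 1]` of the nets. -/
abbrev Index : Type := Set.Ioc (0 : ℝ) 1

/-- The filter expressing "for small `ε`": a property holds eventually along `small` iff there is
`η > 0` such that it holds for all `ε ∈ (0, 1]` with `ε < η`. -/
def small : Filter Index := Filter.comap ((↑) : Index → ℝ) (nhds 0)

theorem eventually_small_iff {P : Index → Prop} :
    (∀ᶠ ε in small, P ε) ↔ ∃ η : ℝ, 0 < η ∧ ∀ ε : Index, (ε : ℝ) < η → P ε := by
  rw [small, ((nhds_basis_Ioo_pos (0 : ℝ)).comap _).eventually_iff]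
  constructor
  · rintro ⟨η, hη, h⟩
    exact ⟨η, hη, fun ε hε => h ⟨by linarith [ε.2.1], by simpa using hε⟩⟩
  · rintro ⟨η, hη, h⟩
    exact ⟨η, hη, fun ε hε => h ε (by simpa using hε.2)⟩

/-- `ℝ^d` with the Euclidean norm. -/
abbrev Euc (d : ℕ) : Type := EuclideanSpace ℝ (Fin d)

/-! ### Nets that are moderate or negligible uniformly on a set -/

section Nets

variable {X F G : Type*} [NormedAddCommGroup F] [NormedAddCommGroup G]

/-- `sup_{x ∈ S} ‖u_ε(x)‖ ≤ ε^{-N}` for small `ε`, for some `N`. -/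
def ModerateOn (S : Set X) (u : Index → X → F) : Prop :=
  ∃ N : ℕ, ∀ᶠ ε in small, ∀ x ∈ S, ‖u ε x‖ ≤ ((ε : ℝ) ^ N)⁻¹

/-- `sup_{x ∈ S} ‖u_ε(x)‖ ≤ ε^m` for small `ε`, for every `m`. -/
def NegligibleOn (S : Set X) (u : Index → X → F) : Prop :=
  ∀ m : ℕ, ∀ᶠ ε in small, ∀ x ∈ S, ‖u ε x‖ ≤ (ε : ℝ) ^ m

theorem eventually_const_le (C : ℝ) : ∀ᶠ ε : Index in small, C ≤ (ε : ℝ)⁻¹ := by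
  rw [eventually_small_iff]
  refine ⟨(|C| + 1)⁻¹, by positivity, fun ε hε => ?_⟩
  have h := (lt_inv_comm₀ ε.2.1 (by positivity)).1 hε
  linarith [le_abs_self C]

theorem inv_pow_mono (ε : Index) {m n : ℕ} (h : m ≤ n) :
    ((ε : ℝ) ^ m)⁻¹ ≤ ((ε : ℝ) ^ n)⁻¹ :=
  inv_anti₀ (pow_pos ε.2.1 _) (pow_le_pow_of_le_one ε.2.1.le ε.2.2 h)

theorem ModerateOn.of_bound {S : Set X} {u : Index → X → F} {v : Index → X → G} (C : ℝ)
    (hu : ModerateOn S u) (h : ∀ ε, ∀ x ∈ S, ‖v ε x‖ ≤ C * ‖u ε x‖) : ModerateOn S v := by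
  obtain ⟨N, hN⟩ := hu
  refine ⟨N + 1, ?_⟩
  filter_upwards [hN, eventually_const_le C] with ε h1 h2 x hx
  have hp : 0 < (ε : ℝ) := ε.2.1
  calc ‖v ε x‖ ≤ C * ‖u ε x‖ := h ε x hx
    _ ≤ (ε : ℝ)⁻¹ * ‖u ε x‖ := by gcongr
    _ ≤ (ε : ℝ)⁻¹ * ((ε : ℝ) ^ N)⁻¹ := by gcongr; exact h1 x hx
    _ = ((ε : ℝ) ^ (N + 1))⁻¹ := by rw [pow_succ, mul_inv, mul_comm]

theorem NegligibleOn.of_bound {S : Set X} {u : Index → X → F} {v : Index → X → G} (C : ℝ)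
    (hu : NegligibleOn S u) (h : ∀ ε, ∀ x ∈ S, ‖v ε x‖ ≤ C * ‖u ε x‖) : NegligibleOn S v := by
  intro m
  filter_upwards [hu (m + 1), eventually_const_le C] with ε h1 h2 x hx
  have hp : 0 < (ε : ℝ) := ε.2.1
  calc ‖v ε x‖ ≤ C * ‖u ε x‖ := h ε x hx
    _ ≤ (ε : ℝ)⁻¹ * ‖u ε x‖ := by gcongr
    _ ≤ (ε : ℝ)⁻¹ * (ε : ℝ) ^ (m + 1) := by gcongr; exact h1 x hx
    _ = (ε : ℝ) ^ m := by rw [pow_succ]; field_simp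

theorem ModerateOn.of_const {S : Set X} {v : Index → X → G} (C : ℝ)
    (h : ∀ ε, ∀ x ∈ S, ‖v ε x‖ ≤ C) : ModerateOn S v := by
  refine ⟨1, ?_⟩
  filter_upwards [eventually_const_le C] with ε h2 x hx
  simpa using (h ε x hx).trans h2

theorem ModerateOn.zero (S : Set X) : ModerateOn S (fun _ _ => (0 : F)) :=
  .of_const 0 (by simp)

theorem NegligibleOn.zero (S : Set X) : NegligibleOn S (fun _ _ => (0 : F)) := by
  intro m
  refine Filter.Eventually.of_forall fun ε x _ => ?_
  have := ε.2.1
  simp only [norm_zero]; positivity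

theorem ModerateOn.add {S : Set X} {u v : Index → X → F} (hu : ModerateOn S u)
    (hv : ModerateOn S v) : ModerateOn S (fun ε x => u ε x + v ε x) := by
  obtain ⟨N, hN⟩ := hu
  obtain ⟨M, hM⟩ := hv
  refine ⟨max N M + 1, ?_⟩
  filter_upwards [hN, hM, eventually_const_le 2] with ε h1 h2 h3 x hx
  have hp : 0 < (ε : ℝ) := ε.2.1
  calc ‖u ε x + v ε x‖ ≤ ‖u ε x‖ + ‖v ε x‖ := norm_add_le _ _
    _ ≤ ((ε : ℝ) ^ max N M)⁻¹ + ((ε : ℝ) ^ max N M)⁻¹ := by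
        gcongr
        · exact (h1 x hx).trans (inv_pow_mono ε (le_max_left _ _))
        · exact (h2 x hx).trans (inv_pow_mono ε (le_max_right _ _))
    _ = 2 * ((ε : ℝ) ^ max N M)⁻¹ := by ring
    _ ≤ (ε : ℝ)⁻¹ * ((ε : ℝ) ^ max N M)⁻¹ := by gcongr
    _ = ((ε : ℝ) ^ (max N M + 1))⁻¹ := by rw [pow_succ, mul_inv, mul_comm]

theorem NegligibleOn.add {S : Set X} {u v : Index → X → F} (hu : NegligibleOn S u)
    (hv : NegligibleOn S v) : NegligibleOn S (fun ε x => u ε x + v ε x) := by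
  intro m
  filter_upwards [hu (m + 1), hv (m + 1), eventually_const_le 2] with ε h1 h2 h3 x hx
  have hp : 0 < (ε : ℝ) := ε.2.1
  calc ‖u ε x + v ε x‖ ≤ ‖u ε x‖ + ‖v ε x‖ := norm_add_le _ _
    _ ≤ (ε : ℝ) ^ (m + 1) + (ε : ℝ) ^ (m + 1) := add_le_add (h1 x hx) (h2 x hx)
    _ = 2 * (ε : ℝ) ^ (m + 1) := by ring
    _ ≤ (ε : ℝ)⁻¹ * (ε : ℝ) ^ (m + 1) := by gcongr
    _ = (ε : ℝ) ^ m := by rw [pow_succ]; field_simp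

theorem ModerateOn.mul_norms {S : Set X} {u : Index → X → F} {v : Index → X → G}
    (hu : ModerateOn S u) (hv : ModerateOn S v) :
    ModerateOn S (fun ε x => ‖u ε x‖ * ‖v ε x‖) := by
  obtain ⟨N, hN⟩ := hu
  obtain ⟨M, hM⟩ := hv
  refine ⟨N + M, ?_⟩
  filter_upwards [hN, hM] with ε h1 h2 x hx
  have hp : 0 < (ε : ℝ) := ε.2.1
  rw [norm_mul, norm_norm, norm_norm, pow_add, mul_inv]
  exact mul_le_mul (h1 x hx) (h2 x hx) (norm_nonneg _) (by positivity)

theorem NegligibleOn.mul_norms {S : Set X} {u : Index → X → F} {v : Index → X → G}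
    (hu : ModerateOn S u) (hv : NegligibleOn S v) :
    NegligibleOn S (fun ε x => ‖u ε x‖ * ‖v ε x‖) := by
  obtain ⟨N, hN⟩ := hu
  intro m
  filter_upwards [hN, hv (N + m)] with ε h1 h2 x hx
  have hp : 0 < (ε : ℝ) := ε.2.1
  rw [norm_mul, norm_norm, norm_norm]
  calc ‖u ε x‖ * ‖v ε x‖ ≤ ((ε : ℝ) ^ N)⁻¹ * (ε : ℝ) ^ (N + m) :=
        mul_le_mul (h1 x hx) (h2 x hx) (norm_nonneg _) (by positivity)
    _ = (ε : ℝ) ^ m := by rw [pow_add]; field_simp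

theorem ModerateOn.sum {ι : Type*} (s : Finset ι) {S : Set X} {u : ι → Index → X → F}
    (h : ∀ i ∈ s, ModerateOn S (u i)) : ModerateOn S (fun ε x => ∑ i ∈ s, u i ε x) := by
  classical
  induction s using Finset.induction_on with
  | empty => simpa using ModerateOn.zero S
  | insert a s ha ih =>
    simp only [Finset.sum_insert ha]
    exact (h a (by simp)).add (ih fun i hi => h i (by simp [hi]))

theorem NegligibleOn.sum {ι : Type*} (s : Finset ι) {S : Set X} {u : ι → Index → X → F}
    (h : ∀ i ∈ s, NegligibleOn S (u i)) : NegligibleOn S (fun ε x => ∑ i ∈ s, u i ε x) := by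
  classical
  induction s using Finset.induction_on with
  | empty => simpa using NegligibleOn.zero S
  | insert a s ha ih =>
    simp only [Finset.sum_insert ha]
    exact (h a (by simp)).add (ih fun i hi => h i (by simp [hi]))

theorem ModerateOn.union {S T : Set X} {u : Index → X → F} (hS : ModerateOn S u)
    (hT : ModerateOn T u) : ModerateOn (S ∪ T) u := by
  obtain ⟨N, hN⟩ := hS
  obtain ⟨M, hM⟩ := hT
  refine ⟨max N M, ?_⟩
  filter_upwards [hN, hM] with ε h1 h2 x hx
  rcases hx with hx | hx
  · exact (h1 x hx).trans (inv_pow_mono ε (le_max_left _ _))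
  · exact (h2 x hx).trans (inv_pow_mono ε (le_max_right _ _))

end Nets

/-! ### Generalized points: the module `𝒢_V` for a finite-dimensional (normed) space `V` -/

section Points

variable (V : Type*) [NormedAddCommGroup V]

/-- The moderate nets in `V`. -/
def moderatePoints : AddSubgroup (Index → V) where
  carrier := {x | ∃ N : ℕ, ∀ᶠ ε in small, ‖x ε‖ ≤ ((ε : ℝ) ^ N)⁻¹}
  zero_mem' := by simpa [ModerateOn] using ModerateOn.zero (F := V) (Set.univ : Set Unit)
  add_mem' {u v} hu hv := by
    simpa [ModerateOn] using ModerateOn.add (S := (Set.univ : Set Unit))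
      (u := fun ε _ => u ε) (v := fun ε _ => v ε)
      (by simpa [ModerateOn] using hu) (by simpa [ModerateOn] using hv)
  neg_mem' {u} hu := by simpa using hu

/-- The negligible nets in `V`. -/
def negligiblePoints : AddSubgroup (moderatePoints V) where
  carrier := {x | ∀ m : ℕ, ∀ᶠ ε in small, ‖x.1 ε‖ ≤ (ε : ℝ) ^ m}
  zero_mem' := by simpa [NegligibleOn] using NegligibleOn.zero (F := V) (Set.univ : Set Unit)
  add_mem' {u v} hu hv := by
    simpa [NegligibleOn] using NegligibleOn.add (S := (Set.univ : Set Unit))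
      (u := fun ε _ => u.1 ε) (v := fun ε _ => v.1 ε)
      (by simpa [NegligibleOn] using hu) (by simpa [NegligibleOn] using hv)
  neg_mem' {u} hu := by simpa using hu

/-- Moderate nets in `V` modulo negligible nets: for `V = ℂ` these are the Colombeau generalized
constants, for `V = ℝ^d` the `d`-dimensional generalized points. -/
abbrev GenPoint : Type _ := moderatePoints V ⧸ negligiblePoints V

variable {V}

/-- The class of a moderate net of points. -/
def GenPoint.mk (x : moderatePoints V) : GenPoint V := QuotientAddGroup.mk x

theorem GenPoint.mk_eq_mk {x y : moderatePoints V} :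
    GenPoint.mk x = GenPoint.mk y ↔ ∀ m : ℕ, ∀ᶠ ε in small, ‖x.1 ε - y.1 ε‖ ≤ (ε : ℝ) ^ m := by
  rw [eq_comm, GenPoint.mk, GenPoint.mk, QuotientAddGroup.eq]
  have : (-y + x) ∈ negligiblePoints V ↔
      ∀ m : ℕ, ∀ᶠ ε in small, ‖(-y + x).1 ε‖ ≤ (ε : ℝ) ^ m := Iff.rfl
  rw [this]
  have h2 : ∀ ε, (-y + x).1 ε = x.1 ε - y.1 ε := fun ε => by
    simp [sub_eq_add_neg, add_comm]
  simp only [h2]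

/-- A generalized point is of slow scale if it has a representative `(x_ε)` such that for each
real `a > 0`, `‖x_ε‖ ≤ ε^{-a}` for small `ε`. -/
def GenPoint.IsSlowScale (ξ : GenPoint V) : Prop :=
  ∃ x : moderatePoints V, GenPoint.mk x = ξ ∧
    ∀ a : ℝ, 0 < a → ∀ᶠ ε : Index in small, ‖x.1 ε‖ ≤ (ε : ℝ) ^ (-a)

end Points

/-! ### The special Colombeau algebra `𝒢(ℝ^d)` -/

section Functions

variable (d : ℕ)

theorem moderateOn_iteratedFDeriv_mul {d : ℕ} {u v : Index → Euc d → ℂ}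
    (hu : ∀ ε, ContDiff ℝ ∞ (u ε)) (hv : ∀ ε, ContDiff ℝ ∞ (v ε)) {K : Set (Euc d)}
    (hu' : ∀ k : ℕ, ModerateOn K (fun ε => iteratedFDeriv ℝ k (u ε)))
    (hv' : ∀ k : ℕ, ModerateOn K (fun ε => iteratedFDeriv ℝ k (v ε))) (k : ℕ) :
    ModerateOn K (fun ε => iteratedFDeriv ℝ k ((u * v) ε)) := by
  have h := ModerateOn.sum (Finset.range (k + 1)) (S := K)
    (u := fun i ε x => (k.choose i : ℝ) *
      (‖iteratedFDeriv ℝ i (u ε) x‖ * ‖iteratedFDeriv ℝ (k - i) (v ε) x‖))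
    (fun i _ => ((hu' i).mul_norms (hv' (k - i))).of_bound (k.choose i : ℝ) (by simp))
  refine h.of_bound 1 fun ε x _ => ?_
  rw [one_mul, Real.norm_eq_abs]
  refine le_trans ?_ (le_abs_self _)
  simpa only [mul_assoc, Pi.mul_apply, Pi.mul_def] using norm_iteratedFDeriv_mul_le (hu ε) (hv ε) x
    (n := k) (by exact_mod_cast le_top)

theorem negligibleOn_iteratedFDeriv_mul {d : ℕ} {u v : Index → Euc d → ℂ}
    (hu : ∀ ε, ContDiff ℝ ∞ (u ε)) (hv : ∀ ε, ContDiff ℝ ∞ (v ε)) {K : Set (Euc d)}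
    (hu' : ∀ k : ℕ, ModerateOn K (fun ε => iteratedFDeriv ℝ k (u ε)))
    (hv' : ∀ k : ℕ, NegligibleOn K (fun ε => iteratedFDeriv ℝ k (v ε))) (k : ℕ) :
    NegligibleOn K (fun ε => iteratedFDeriv ℝ k ((u * v) ε)) := by
  have h := NegligibleOn.sum (Finset.range (k + 1)) (S := K)
    (u := fun i ε x => (k.choose i : ℝ) *
      (‖iteratedFDeriv ℝ i (u ε) x‖ * ‖iteratedFDeriv ℝ (k - i) (v ε) x‖))
    (fun i _ => (NegligibleOn.mul_norms (hu' i) (hv' (k - i))).of_bound (k.choose i : ℝ) (by simp))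
  refine h.of_bound 1 fun ε x _ => ?_
  rw [one_mul, Real.norm_eq_abs]
  refine le_trans ?_ (le_abs_self _)
  simpa only [mul_assoc, Pi.mul_apply, Pi.mul_def] using norm_iteratedFDeriv_mul_le (hu ε) (hv ε) x
    (n := k) (by exact_mod_cast le_top)

theorem moderateOn_const_net {d : ℕ} {φ : Euc d → ℂ} (hφ : ContDiff ℝ ∞ φ) {K : Set (Euc d)}
    (hK : IsCompact K) (k : ℕ) :
    ModerateOn K (fun _ : Index => iteratedFDeriv ℝ k φ) := by
  obtain ⟨C, hC⟩ := hK.exists_bound_of_continuousOn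
    (hφ.continuous_iteratedFDeriv (m := k) (by exact_mod_cast le_top)).continuousOn
  exact .of_const C fun _ x hx => hC x hx

theorem iteratedFDeriv_add_net {d : ℕ} {u v : Euc d → ℂ} (hu : ContDiff ℝ ∞ u)
    (hv : ContDiff ℝ ∞ v) (k : ℕ) (x : Euc d) :
    iteratedFDeriv ℝ k (u + v) x = iteratedFDeriv ℝ k u x + iteratedFDeriv ℝ k v x :=
  iteratedFDeriv_add_apply ((hu.of_le (by exact_mod_cast le_top)).contDiffAt)
    ((hv.of_le (by exact_mod_cast le_top)).contDiffAt)

/-- The moderate nets of smooth functions `ℝ^d → ℂ`: all derivatives are, uniformly on each compact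
set, bounded by a negative power of `ε`. -/
def moderateNets : Subalgebra ℂ (Index → Euc d → ℂ) where
  carrier := {u | (∀ ε, ContDiff ℝ ∞ (u ε)) ∧ ∀ K : Set (Euc d), IsCompact K → ∀ k : ℕ,
    ModerateOn K (fun ε => iteratedFDeriv ℝ k (u ε))}
  mul_mem' {u v} hu hv := ⟨fun ε => (hu.1 ε).mul (hv.1 ε), fun K hK k =>
    moderateOn_iteratedFDeriv_mul hu.1 hv.1 (hu.2 K hK) (hv.2 K hK) k⟩
  add_mem' {u v} hu hv := ⟨fun ε => (hu.1 ε).add (hv.1 ε), fun K hK k => by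
    refine ((hu.2 K hK k).add (hv.2 K hK k)).of_bound 1 fun ε x _ => ?_
    rw [one_mul]
    exact (congrArg norm (iteratedFDeriv_add_net (hu.1 ε) (hv.1 ε) k x)).le⟩
  algebraMap_mem' c := ⟨fun _ => contDiff_const, fun _ hK k =>
    moderateOn_const_net (φ := fun _ => c) contDiff_const hK k⟩

/-- The negligible nets of smooth functions `ℝ^d → ℂ`: all derivatives are, uniformly on each
compact set, bounded by every power of `ε`. -/
def negligibleNets : Ideal (moderateNets d) where
  carrier := {u | ∀ K : Set (Euc d), IsCompact K → ∀ k : ℕ,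
    NegligibleOn K (fun ε => iteratedFDeriv ℝ k (u.1 ε))}
  zero_mem' K _ k := by
    refine (NegligibleOn.zero (F := ℂ) K).of_bound 1 fun ε x _ => ?_
    have : iteratedFDeriv ℝ k ((0 : moderateNets d).1 ε) x = 0 := by
      change iteratedFDeriv ℝ k (fun _ : Euc d => (0 : ℂ)) x = 0
      simp
    rw [this]
    simp
  add_mem' {u v} hu hv K hK k := by
    refine ((hu K hK k).add (hv K hK k)).of_bound 1 fun ε x _ => ?_
    rw [one_mul]
    exact (congrArg norm (iteratedFDeriv_add_net (u.2.1 ε) (v.2.1 ε) k x)).le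
  smul_mem' u v hv K hK k :=
    negligibleOn_iteratedFDeriv_mul u.2.1 v.2.1 (u.2.2 K hK) (hv K hK) k

/-- The special Colombeau algebra of generalized functions on `ℝ^d`. -/
def GenFun : Type := moderateNets d ⧸ negligibleNets d

instance : CommRing (GenFun d) := inferInstanceAs (CommRing (moderateNets d ⧸ negligibleNets d))

variable {d}

/-- The class of a moderate net of smooth functions. -/
def GenFun.mk : moderateNets d →+* GenFun d := Ideal.Quotient.mk (negligibleNets d)

theorem GenFun.mk_eq_mk {u v : moderateNets d} : GenFun.mk u = GenFun.mk v ↔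
    ∀ K : Set (Euc d), IsCompact K → ∀ k : ℕ,
      NegligibleOn K (fun ε => iteratedFDeriv ℝ k (u.1 ε - v.1 ε)) :=
  Ideal.Quotient.eq

/-- The embedding of the smooth functions, by constant nets. -/
def GenFun.ofSmooth (φ : Euc d → ℂ) (hφ : ContDiff ℝ ∞ φ) : GenFun d :=
  GenFun.mk ⟨fun _ => φ, fun _ => hφ, fun _ hK k => moderateOn_const_net hφ hK k⟩

/-- The test functions `𝒟(ℝ^d)` as elements of `𝒢(ℝ^d)`. -/
def GenFun.ofTest (φ : 𝓓((⊤ : TopologicalSpace.Opens (Euc d)), ℂ)) : GenFun d :=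
  GenFun.ofSmooth φ φ.contDiff

/-- The supports of all the functions of the net lie in one compact set. -/
def HasCompactSupportNet (u : moderateNets d) : Prop :=
  ∃ K : Set (Euc d), IsCompact K ∧ ∀ ε, tsupport (u.1 ε) ⊆ K

variable (d)

/-- The compactly supported generalized functions `𝒢_c(ℝ^d)`: those having a representative whose
supports lie in one compact set. -/
def Gc : Ideal (GenFun d) where
  carrier := {f | ∃ u : moderateNets d, GenFun.mk u = f ∧ HasCompactSupportNet u}
  zero_mem' := ⟨0, map_zero _, ∅, isCompact_empty, fun ε => by
    change tsupport (fun _ : Euc d => (0 : ℂ)) ⊆ ∅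
    simp [tsupport]⟩
  add_mem' := by
    rintro _ _ ⟨u, rfl, K, hK, hu⟩ ⟨v, rfl, L, hL, hv⟩
    exact ⟨u + v, map_add _ _ _, K ∪ L, hK.union hL, fun ε =>
      (tsupport_add _ _).trans (Set.union_subset_union (hu ε) (hv ε))⟩
  smul_mem' := by
    rintro c _ ⟨v, rfl, L, hL, hv⟩
    obtain ⟨u, rfl⟩ : ∃ u, GenFun.mk u = c := Ideal.Quotient.mk_surjective c
    exact ⟨u * v, map_mul _ _ _, L, hL, fun ε =>
      (tsupport_mul_subset_right (f := u.1 ε) (g := v.1 ε)).trans (hv ε)⟩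

/-- The regular generalized functions `𝒢^∞(ℝ^d)`: those having a representative for which, on each
compact set, all derivatives are bounded by one and the same negative power of `ε`. -/
def GInf : Set (GenFun d) :=
  {f | ∃ u : moderateNets d, GenFun.mk u = f ∧ ∀ K : Set (Euc d), IsCompact K →
    ∃ N : ℕ, ∀ k : ℕ, ∀ᶠ ε in small, ∀ x ∈ K,
      ‖iteratedFDeriv ℝ k (u.1 ε) x‖ ≤ ((ε : ℝ) ^ N)⁻¹}

/-- `𝒢_c^∞(ℝ^d) = 𝒢^∞(ℝ^d) ∩ 𝒢_c(ℝ^d)`. -/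
def GcInf : Set (GenFun d) := GInf d ∩ (Gc d : Set (GenFun d))

end Functions

/-! ### Integration and Fourier transform on `𝒢_c(ℝ^d)` -/

section Integration

open MeasureTheory

variable {d : ℕ}

theorem norm_integral_le_of_compact {K : Set (Euc d)} (hK : IsCompact K) {g : Euc d → ℂ}
    (h0 : ∀ x ∉ K, g x = 0) {C : ℝ} (hC : ∀ x ∈ K, ‖g x‖ ≤ C) :
    ‖∫ x, g x‖ ≤ volume.real K * C := by
  rw [← setIntegral_eq_integral_of_forall_compl_eq_zero h0, mul_comm]
  exact norm_setIntegral_le_of_norm_le_const hK.measure_lt_top hC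

theorem integral_mem_moderatePoints {K : Set (Euc d)} (hK : IsCompact K) {g : Index → Euc d → ℂ}
    (h0 : ∀ ε, ∀ x ∉ K, g ε x = 0) (hg : ModerateOn K g) :
    (fun ε => ∫ x, g ε x) ∈ moderatePoints ℂ := by
  obtain ⟨N, hN⟩ := hg
  refine ⟨N + 1, ?_⟩
  filter_upwards [hN, eventually_const_le (volume.real K)] with ε h1 h2
  have hp : 0 < (ε : ℝ) := ε.2.1
  calc ‖∫ x, g ε x‖ ≤ volume.real K * ((ε : ℝ) ^ N)⁻¹ :=
        norm_integral_le_of_compact hK (h0 ε) h1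
    _ ≤ (ε : ℝ)⁻¹ * ((ε : ℝ) ^ N)⁻¹ := by gcongr
    _ = ((ε : ℝ) ^ (N + 1))⁻¹ := by rw [pow_succ, mul_inv, mul_comm]

theorem integral_negligible {K : Set (Euc d)} (hK : IsCompact K) {g : Index → Euc d → ℂ}
    (h0 : ∀ ε, ∀ x ∉ K, g ε x = 0) (hg : NegligibleOn K g) (m : ℕ) :
    ∀ᶠ ε in small, ‖∫ x, g ε x‖ ≤ (ε : ℝ) ^ m := by
  filter_upwards [hg (m + 1), eventually_const_le (volume.real K)] with ε h1 h2
  have hp : 0 < (ε : ℝ) := ε.2.1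
  calc ‖∫ x, g ε x‖ ≤ volume.real K * (ε : ℝ) ^ (m + 1) :=
        norm_integral_le_of_compact hK (h0 ε) h1
    _ ≤ (ε : ℝ)⁻¹ * (ε : ℝ) ^ (m + 1) := by gcongr
    _ = (ε : ℝ) ^ m := by rw [pow_succ]; field_simp

theorem eq_zero_of_tsupport_subset {g : Euc d → ℂ} {K : Set (Euc d)} (h : tsupport g ⊆ K)
    (x : Euc d) (hx : x ∉ K) : g x = 0 :=
  image_eq_zero_of_notMem_tsupport fun hx' => hx (h hx')

theorem moderateOn_net (u : moderateNets d) {K : Set (Euc d)} (hK : IsCompact K) :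
    ModerateOn K u.1 :=
  (u.2.2 K hK 0).of_bound 1 fun ε x _ => by simp

theorem negligibleOn_sub {u v : moderateNets d} (h : GenFun.mk u = GenFun.mk v)
    {K : Set (Euc d)} (hK : IsCompact K) : NegligibleOn K (fun ε x => u.1 ε x - v.1 ε x) :=
  (GenFun.mk_eq_mk.1 h K hK 0).of_bound 1 fun ε x _ => by simp

/-- The net `(∫ u_ε)` of a moderate net with supports in one compact set. -/
def integralNet (u : moderateNets d) (hu : HasCompactSupportNet u) :
    moderatePoints ℂ :=
  ⟨fun ε => ∫ x, u.1 ε x, by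
    obtain ⟨K, hK, h⟩ := hu
    exact integral_mem_moderatePoints hK (fun ε => eq_zero_of_tsupport_subset (h ε))
      (moderateOn_net u hK)⟩

/-- A compactly supported representative of an element of `𝒢_c(ℝ^d)`. -/
def gcRep (f : Gc d) : moderateNets d := Classical.choose f.2

theorem mk_gcRep (f : Gc d) : GenFun.mk (gcRep f) = f.1 := (Classical.choose_spec f.2).1

theorem hasCompactSupportNet_gcRep (f : Gc d) : HasCompactSupportNet (gcRep f) :=
  (Classical.choose_spec f.2).2

/-- The integral `∫ f ∈ ℂ~` of `f ∈ 𝒢_c(ℝ^d)`, computed on any compactly supported representative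
(see `integral_eq`). -/
def integral (f : Gc d) : GenPoint ℂ :=
  GenPoint.mk (integralNet (gcRep f) (hasCompactSupportNet_gcRep f))

theorem integrable_net (u : moderateNets d) (hu : HasCompactSupportNet u) (ε : Index) :
    Integrable (u.1 ε) := by
  obtain ⟨K, hK, h⟩ := hu
  exact (u.2.1 ε).continuous.integrable_of_hasCompactSupport
    (hK.of_isClosed_subset (isClosed_tsupport _) (h ε))

theorem integral_eq (f : Gc d) (u : moderateNets d) (hu : HasCompactSupportNet u)
    (h : GenFun.mk u = f.1) : integral f = GenPoint.mk (integralNet u hu) := by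
  have hv := (hasCompactSupportNet_gcRep f)
  have huv : GenFun.mk (gcRep f) = GenFun.mk u := (mk_gcRep f).trans h.symm
  refine GenPoint.mk_eq_mk.2 fun m => ?_
  obtain ⟨K, hK, hKs⟩ := hv
  obtain ⟨L, hL, hLs⟩ := hu
  filter_upwards [integral_negligible (hK.union hL) (g := fun ε x => (gcRep f).1 ε x - u.1 ε x)
    (fun ε x hx => by
      rw [eq_zero_of_tsupport_subset (hKs ε) x fun h => hx (.inl h),
        eq_zero_of_tsupport_subset (hLs ε) x fun h => hx (.inr h), sub_zero])
    (negligibleOn_sub huv (hK.union hL)) m] with ε hε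
  rwa [integral_sub (integrable_net _ ⟨K, hK, hKs⟩ ε) (integrable_net _ ⟨L, hL, hLs⟩ ε)] at hε

/-- `∫ f φ ∈ ℂ~` for `f ∈ 𝒢_c(ℝ^d)` and `φ ∈ 𝒢(ℝ^d)`. -/
def pairing (f : Gc d) (φ : GenFun d) : GenPoint ℂ :=
  integral ⟨f.1 * φ, (Gc d).mul_mem_right φ f.2⟩

/-- `e^{-i ξ·x}`. -/
def character (ξ x : Euc d) : ℂ := Complex.exp (-(Complex.I * (inner ℝ ξ x : ℝ)))

theorem norm_character (ξ x : Euc d) : ‖character ξ x‖ = 1 := by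
  rw [character, Complex.norm_exp]
  simp

theorem continuous_character (ξ : Euc d) : Continuous (character ξ) := by
  unfold character
  fun_prop

theorem norm_character_sub_le (ξ η x : Euc d) :
    ‖character ξ x - character η x‖ ≤ ‖ξ - η‖ * ‖x‖ := by
  have h : character ξ x - character η x =
      character η x * (Complex.exp (Complex.I * ((-(inner ℝ (ξ - η) x) : ℝ) : ℂ)) - 1) := by
    rw [mul_sub, mul_one]
    congr 1
    rw [character, character, ← Complex.exp_add]
    congr 1
    rw [inner_sub_left]
    push_cast
    ring
  rw [h, norm_mul, norm_character, one_mul]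
  refine (Real.norm_exp_I_mul_ofReal_sub_one_le).trans ?_
  rw [norm_neg]
  exact norm_inner_le_norm _ _

/-- The net `(∫ u_ε(x) e^{-i ξ_ε·x} dx)`. -/
def fourierNet (u : moderateNets d) (hu : HasCompactSupportNet u)
    (ξ : moderatePoints (Euc d)) : moderatePoints ℂ :=
  ⟨fun ε => ∫ x, u.1 ε x * character (ξ.1 ε) x, by
    obtain ⟨K, hK, h⟩ := hu
    exact integral_mem_moderatePoints hK
      (fun ε x hx => by rw [eq_zero_of_tsupport_subset (h ε) x hx, zero_mul])
      ((moderateOn_net u hK).of_bound 1 fun ε x _ => by simp [norm_character])⟩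

/-- The Fourier transform `f^(ξ) = ∫ f(x) e^{-i ξ·x} dx ∈ ℂ~` of `f ∈ 𝒢_c(ℝ^d)` at a generalized
point `ξ`, computed on any compactly supported representative of `f` and any representative of `ξ`
(see `fourier_eq`). -/
def fourier (f : Gc d) (ξ : GenPoint (Euc d)) : GenPoint ℂ :=
  GenPoint.mk (fourierNet (gcRep f) (hasCompactSupportNet_gcRep f) (Quotient.out ξ))

theorem fourier_eq (f : Gc d) (u : moderateNets d) (hu : HasCompactSupportNet u)
    (h : GenFun.mk u = f.1) (ξ : moderatePoints (Euc d)) :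
    fourier f (GenPoint.mk ξ) = GenPoint.mk (fourierNet u hu ξ) := by
  have hv := (hasCompactSupportNet_gcRep f)
  have huv : GenFun.mk (gcRep f) = GenFun.mk u := (mk_gcRep f).trans h.symm
  set η : moderatePoints (Euc d) := Quotient.out (GenPoint.mk ξ) with hη
  have hηξ : GenPoint.mk η = GenPoint.mk ξ := Quotient.out_eq _
  have hneg := GenPoint.mk_eq_mk.1 hηξ
  have hint : ∀ (w : moderateNets d), HasCompactSupportNet w → ∀ ε (ζ : Euc d),
      Integrable fun x => w.1 ε x * character ζ x := by
    rintro w ⟨K, hK, hw⟩ ε ζ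
    refine ((w.2.1 ε).continuous.mul (continuous_character ζ)).integrable_of_hasCompactSupport ?_
    exact hK.of_isClosed_subset (isClosed_tsupport _)
      ((tsupport_mul_subset_left (f := w.1 ε) (g := character ζ)).trans (hw ε))
  refine GenPoint.mk_eq_mk.2 fun m => ?_
  obtain ⟨K, hK, hKs⟩ := hv
  obtain ⟨L, hL, hLs⟩ := hu
  have hKL := hK.union hL
  obtain ⟨R, hR⟩ := hKL.exists_bound_of_continuousOn (continuous_id (X := Euc d)).continuousOn
  have h1 : NegligibleOn (K ∪ L)
      (fun ε x => ((gcRep f).1 ε x - u.1 ε x) * character (η.1 ε) x) :=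
    (negligibleOn_sub huv hKL).of_bound 1 fun ε x _ => by simp [norm_character]
  have h2' : NegligibleOn (K ∪ L) (fun ε (_ : Euc d) => η.1 ε - ξ.1 ε) := fun m => by
    filter_upwards [hneg m] with ε hε x _ using hε
  have h2 : NegligibleOn (K ∪ L)
      (fun ε x => u.1 ε x * (character (η.1 ε) x - character (ξ.1 ε) x)) :=
    (NegligibleOn.mul_norms (moderateOn_net u hKL) h2').of_bound R fun ε x hx => by
      rw [norm_mul, norm_mul, norm_norm, norm_norm]
      have hb := norm_character_sub_le (η.1 ε) (ξ.1 ε) x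
      have hx' : ‖x‖ ≤ R := hR x hx
      calc ‖u.1 ε x‖ * ‖character (η.1 ε) x - character (ξ.1 ε) x‖
          ≤ ‖u.1 ε x‖ * (‖η.1 ε - ξ.1 ε‖ * R) := by
            gcongr
            exact hb.trans (by gcongr)
        _ = R * (‖u.1 ε x‖ * ‖η.1 ε - ξ.1 ε‖) := by ring
  filter_upwards [integral_negligible hKL
    (g := fun ε x => (gcRep f).1 ε x * character (η.1 ε) x - u.1 ε x * character (ξ.1 ε) x)
    (fun ε x hx => by
      rw [eq_zero_of_tsupport_subset (hKs ε) x fun h => hx (.inl h),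
        eq_zero_of_tsupport_subset (hLs ε) x fun h => hx (.inr h), zero_mul, zero_mul, sub_zero])
    ((h1.add h2).of_bound 1 fun ε x _ => by
      rw [one_mul]
      exact (congrArg norm (by ring)).le) m] with ε hε
  rwa [integral_sub (hint _ ⟨K, hK, hKs⟩ ε _) (hint _ ⟨L, hL, hLs⟩ ε _)] at hε

end Integration

end Colombeau

end

namespace Colombeau

open MeasureTheory Filter
open scoped FourierTransform SchwartzMap

/-! 2 → 1 holds because constant nets of test functions are regular. 1 → 3 is a uniform boundedness
argument. If `f^(ξ)` is not negligible, some sequence `ε_i → 0` violates the bound `ε^m`. Slow scale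
growth makes `χ · Σ a_i ε_i e^{-iξ_{ε_i}·x}` a test function for every `a ∈ ℓ¹`, where the cut-off
`χ` is 1 on the supports of the `f_ε`. By 1, the functionals `a ↦ ε_j^{-(m+2)} Σ_i a_i ε_i ∫ f_{ε_j}
e^{-iξ_{ε_i}·x}` are pointwise bounded on `ℓ¹`, so by Banach–Steinhaus
(`bounded_of_forall_summable`) their coefficients are uniformly bounded. The diagonal coefficients
contradict the choice of the sequence. 3 → 2: a diagonal argument
(`exists_uniform_of_forall_slowScale`) turns smallness at each slow scale point into uniform
smallness on a ball of radius `ε^{-1/n}`. Outside that ball the transform of `f_ε` is still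
moderate, while that of the cut-off regular function decays to any order at the cost of one fixed
power of `ε`. Parseval (`norm_integral_mul_le_of_fourier_le`) combines the two regions. -/

/-! ### Characters, cut-offs, and vanishing in `ℂ~` as estimates on nets -/

theorem contDiff_character {d : ℕ} (ξ : Euc d) : ContDiff ℝ ∞ (character ξ) := by
  unfold character
  exact (contDiff_const.mul (Complex.ofRealCLM.contDiff.comp
    (contDiff_const.inner ℝ contDiff_id))).neg.cexp

/-- The character is `t ↦ e^{-it}` composed with the linear form `⟨ξ, ·⟩`: the derivatives of the
former are unimodular, and each differentiation contributes one factor of norm `‖ξ‖`. -/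
theorem norm_iteratedFDeriv_character_le {d : ℕ} (ξ x : Euc d) (k : ℕ) :
    ‖iteratedFDeriv ℝ k (character ξ) x‖ ≤ ‖ξ‖ ^ k := by
  have hcomp : character ξ = (fun t : ℝ => Complex.exp (t * (-Complex.I))) ∘ innerSL ℝ ξ := by
    funext y
    simp only [character, Function.comp_apply, innerSL_apply_apply]
    ring_nf
  have hderiv : ∀ (n : ℕ) (t : ℝ),
      iteratedDeriv n (fun t : ℝ => Complex.exp (t * (-Complex.I))) t =
        (-Complex.I) ^ n * Complex.exp (t * (-Complex.I)) := by
    intro n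
    induction n with
    | zero => simp
    | succ n ih =>
      intro t
      rw [iteratedDeriv_succ, funext ih]
      have h : HasDerivAt (fun t : ℝ => Complex.exp (t * (-Complex.I)))
          (Complex.exp (t * (-Complex.I)) * (1 * (-Complex.I))) t :=
        ((Complex.ofRealCLM.hasDerivAt (x := t)).mul_const (-Complex.I)).cexp
      rw [(h.const_mul _).deriv]
      ring
  rw [hcomp, ContinuousLinearMap.iteratedFDeriv_comp_right (innerSL ℝ ξ)
    (f := fun t : ℝ => Complex.exp (t * (-Complex.I))) (n := ∞)
    (Complex.ofRealCLM.contDiff.mul contDiff_const).cexp x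
    (by exact_mod_cast le_top)]
  refine (ContinuousMultilinearMap.norm_compContinuousLinearMap_le _ _).trans ?_
  rw [norm_iteratedFDeriv_eq_norm_iteratedDeriv, hderiv]
  have he : ‖Complex.exp (((innerSL ℝ ξ) x : ℝ) * (-Complex.I))‖ = 1 := by
    rw [← mul_neg_one, Complex.norm_exp]
    simp
  rw [norm_mul, he]
  simp

theorem exists_smooth_cutoff {d : ℕ} {K : Set (Euc d)} (hK : IsCompact K) :
    ∃ χ : Euc d → ℂ, ContDiff ℝ ∞ χ ∧ HasCompactSupport χ ∧ ∀ x ∈ K, χ x = 1 := by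
  obtain ⟨R, hR⟩ := hK.isBounded.subset_closedBall 0
  -- `R` need not be positive, whereas a bump needs a positive inner radius.
  let b : ContDiffBump (0 : Euc d) := ⟨max R 1, max R 1 + 1, by positivity, by linarith⟩
  refine ⟨fun x => (b x : ℂ), Complex.ofRealCLM.contDiff.comp b.contDiff,
    b.hasCompactSupport.comp_left (g := fun r : ℝ => (r : ℂ)) Complex.ofReal_zero, fun x hx => ?_⟩
  have : b x = 1 := b.one_of_mem_closedBall
    (Metric.closedBall_subset_closedBall (le_max_left _ _) (hR hx))
  simp [this]

theorem genPoint_mk_eq_zero_iff {V : Type*} [NormedAddCommGroup V] {x : moderatePoints V} :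
    GenPoint.mk x = 0 ↔ ∀ m : ℕ, ∀ᶠ ε in small, ‖x.1 ε‖ ≤ (ε : ℝ) ^ m := by
  have h : (0 : GenPoint V) = GenPoint.mk 0 := rfl
  rw [h, GenPoint.mk_eq_mk]
  simp

theorem pairing_mk_eq_zero_iff {d : ℕ} {f : Gc d} {u v : moderateNets d}
    (hu : HasCompactSupportNet u) (h : GenFun.mk u = f.1) :
    pairing f (GenFun.mk v) = 0 ↔
      ∀ m : ℕ, ∀ᶠ ε in small, ‖∫ x, u.1 ε x * v.1 ε x‖ ≤ (ε : ℝ) ^ m := by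
  have huv : HasCompactSupportNet (u * v) := by
    obtain ⟨K, hK, hu⟩ := hu
    exact ⟨K, hK, fun ε => (tsupport_mul_subset_left (f := u.1 ε) (g := v.1 ε)).trans (hu ε)⟩
  rw [pairing, integral_eq _ (u * v) huv (by rw [map_mul, h]), genPoint_mk_eq_zero_iff]
  rfl

theorem fourier_mk_eq_zero_iff {d : ℕ} {f : Gc d} {u : moderateNets d}
    (hu : HasCompactSupportNet u) (h : GenFun.mk u = f.1) (ξ : moderatePoints (Euc d)) :
    fourier f (GenPoint.mk ξ) = 0 ↔
      ∀ m : ℕ, ∀ᶠ ε in small, ‖∫ x, u.1 ε x * character (ξ.1 ε) x‖ ≤ (ε : ℝ) ^ m := by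
  rw [fourier_eq f u hu h ξ, genPoint_mk_eq_zero_iff]
  rfl

/-! ### Slow scale nets and the diagonal argument -/

/-- The form with natural powers is the one used below: it says that a single factor `ε` absorbs
every power of the net. -/
theorem slowScale_iff {V : Type*} [NormedAddCommGroup V] {x : Index → V} :
    (∀ a : ℝ, 0 < a → ∀ᶠ ε : Index in small, ‖x ε‖ ≤ (ε : ℝ) ^ (-a)) ↔
      ∀ n : ℕ, ∀ᶠ ε : Index in small, ‖x ε‖ ^ n ≤ (ε : ℝ)⁻¹ := by
  constructor
  · intro h n
    -- The exponent is `1 / (n + 1)` rather than `1 / n` so that `n = 0` is covered; `n / (n + 1) ≤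
    -- 1` suffices.
    filter_upwards [h (1 / (n + 1)) (by positivity)] with ε hε
    have hp : 0 < (ε : ℝ) := ε.2.1
    calc ‖x ε‖ ^ n ≤ ((ε : ℝ) ^ (-(1 / ((n : ℝ) + 1)))) ^ n := by gcongr
      _ = (ε : ℝ) ^ (-(1 / ((n : ℝ) + 1)) * n) := by rw [Real.rpow_mul hp.le, Real.rpow_natCast]
      _ ≤ (ε : ℝ) ^ (-1 : ℝ) := by
          refine Real.rpow_le_rpow_of_exponent_ge hp ε.2.2 ?_
          rw [neg_mul, neg_le_neg_iff, one_div_mul_eq_div, div_le_one (by positivity)]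
          linarith
      _ = (ε : ℝ)⁻¹ := Real.rpow_neg_one _
  · intro h a ha
    obtain ⟨n, hn⟩ := exists_nat_gt (1 / a)
    have hn0 : (0 : ℝ) < n := lt_trans (by positivity) hn
    filter_upwards [h n] with ε hε
    have hp : 0 < (ε : ℝ) := ε.2.1
    have hn0' : n ≠ 0 := by rintro rfl; simp at hn0
    refine (pow_le_pow_iff_left₀ (norm_nonneg _) (by positivity) hn0').1 (hε.trans ?_)
    rw [← Real.rpow_natCast, ← Real.rpow_mul hp.le, ← Real.rpow_neg_one]
    refine Real.rpow_le_rpow_of_exponent_ge hp ε.2.2 ?_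
    rw [div_lt_iff₀ ha] at hn
    linarith

theorem eventually_small_lt {r : ℝ} (hr : 0 < r) : ∀ᶠ ε : Index in small, (ε : ℝ) < r :=
  eventually_small_iff.2 ⟨r, hr, fun _ h => h⟩

instance isCountablyGenerated_small : small.IsCountablyGenerated := by
  unfold small; infer_instance

theorem moderatePoints_of_slowScale {V : Type*} [NormedAddCommGroup V] {x : Index → V}
    (h : ∀ n : ℕ, ∀ᶠ ε : Index in small, ‖x ε‖ ^ n ≤ (ε : ℝ)⁻¹) : x ∈ moderatePoints V :=
  ⟨1, by simpa using h 1⟩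

/-- A diagonal argument: a property that holds at all slow scale nets for small `ε` holds uniformly
on a ball of radius `ε ^ (-1 / n)`. -/
theorem exists_uniform_of_forall_slowScale {V : Type*} [NormedAddCommGroup V]
    {P : Index → V → Prop}
    (h : ∀ x : Index → V, (∀ n : ℕ, ∀ᶠ ε : Index in small, ‖x ε‖ ^ n ≤ (ε : ℝ)⁻¹) →
      ∀ᶠ ε in small, P ε (x ε)) :
    ∃ n : ℕ, ∀ᶠ ε : Index in small, ∀ y : V, ‖y‖ ^ n ≤ (ε : ℝ)⁻¹ → P ε y := by
  classical
  by_contra! hcon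
  have hex : ∀ n : ℕ, ∃ ε : Index, (ε : ℝ) < 1 / (n + 1) ∧ ∃ y : V,
      ‖y‖ ^ n ≤ (ε : ℝ)⁻¹ ∧ ¬ P ε y := fun n => by
    obtain ⟨ε, ⟨y, hy⟩, hε⟩ :=
      ((hcon n).and_eventually (eventually_small_lt (r := 1 / ((n : ℝ) + 1)) (by positivity))).exists
    exact ⟨ε, hε, y, hy⟩
  choose e he y hy hP using hex
  -- The counterexamples are glued into one net. The `e n` need not be distinct; any chosen index
  -- with the same `ε` still violates `P`.
  let x : Index → V := fun ε => if hε : ∃ n, e n = ε then y hε.choose else 0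
  have hx : ∀ n, ¬ P (e n) (x (e n)) := fun n => by
    have hε : ∃ k, e k = e n := ⟨n, rfl⟩
    simp only [x, dif_pos hε]
    have := hP hε.choose
    rwa [hε.choose_spec] at this
  have hslow : ∀ n : ℕ, ∀ᶠ ε : Index in small, ‖x ε‖ ^ n ≤ (ε : ℝ)⁻¹ := fun n => by
    -- Below `e 0, …, e (n-1)` the chosen index is at least `n`, so the bound on its own power
    -- controls the `n`-th power.
    have hsm : ∀ᶠ ε : Index in small, ∀ k ∈ Finset.range n, (ε : ℝ) < e k :=
      (Finset.eventually_all _).2 fun k _ => eventually_small_lt (e k).2.1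
    filter_upwards [hsm] with ε hε
    have hp : 0 < (ε : ℝ) := ε.2.1
    have h1 : 1 ≤ (ε : ℝ)⁻¹ := (one_le_inv₀ hp).2 ε.2.2
    by_cases hk : ∃ k, e k = ε
    · simp only [x, dif_pos hk]
      set k := hk.choose
      have hkε : e k = ε := hk.choose_spec
      have hnk : n ≤ k := by
        by_contra! hlt
        have := hε k (Finset.mem_range.2 hlt)
        rw [hkε] at this
        exact lt_irrefl _ this
      have hyk := hy k
      rw [hkε] at hyk
      rcases le_total ‖y k‖ 1 with hle | hle
      · exact (pow_le_one₀ (norm_nonneg _) hle).trans h1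
      · exact (pow_le_pow_right₀ hle hnk).trans hyk
    · simp only [x, dif_neg hk, norm_zero]
      exact (pow_le_one₀ le_rfl zero_le_one).trans h1
  obtain ⟨η, hη, hηP⟩ := eventually_small_iff.1 (h x hslow)
  obtain ⟨n, hn⟩ := exists_nat_one_div_lt hη
  exact hx n (hηP (e n) ((he n).trans hn))

/-! ### Uniform boundedness and series of characters: 1 → 3 -/

/-- The uniform boundedness principle on `ℓ¹`, for functionals given by bounded sequences. -/
theorem bounded_of_forall_summable {b : ℕ → ℕ → ℂ} (hb : ∀ j, ∃ C : ℝ, ∀ i, ‖b j i‖ ≤ C)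
    (h : ∀ a : ℕ → ℂ, Summable (fun i => ‖a i‖) → ∃ C : ℝ, ∀ j, ‖∑' i, a i * b j i‖ ≤ C) :
    ∃ C : ℝ, ∀ j i, ‖b j i‖ ≤ C := by
  choose B hB using hb
  have hsum : ∀ a : lp (fun _ : ℕ => ℂ) 1, Summable fun i => ‖a i‖ := fun a => by
    simpa using (lp.memℓp a).summable (by simp)
  have hnorm : ∀ a : lp (fun _ : ℕ => ℂ) 1, ‖a‖ = ∑' i, ‖a i‖ := fun a => by
    simpa using lp.norm_eq_tsum_rpow (p := 1) (by simp) a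
  have hle : ∀ j (a : lp (fun _ : ℕ => ℂ) 1) i, ‖a i * b j i‖ ≤ B j * ‖a i‖ := fun j a i => by
    rw [norm_mul, mul_comm]
    exact mul_le_mul_of_nonneg_right (hB j i) (norm_nonneg _)
  have hsum' : ∀ j (a : lp (fun _ : ℕ => ℂ) 1), Summable fun i => a i * b j i := fun j a =>
    ((hsum a).mul_left (B j)).of_norm_bounded (hle j a)
  let T : ℕ → lp (fun _ : ℕ => ℂ) 1 →L[ℂ] ℂ := fun j =>
    LinearMap.mkContinuous
      { toFun := fun a => ∑' i, a i * b j i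
        map_add' := fun a a' => by
          rw [← (hsum' j a).tsum_add (hsum' j a')]
          exact tsum_congr fun i => by simp [add_mul]
        map_smul' := fun c a => by
          rw [RingHom.id_apply, smul_eq_mul, ← tsum_mul_left]
          exact tsum_congr fun i => by simp [mul_assoc] } (B j) fun a => by
      rw [hnorm, ← tsum_mul_left]
      exact tsum_of_norm_bounded ((hsum a).mul_left (B j)).hasSum (hle j a)
  obtain ⟨C, hC⟩ := banach_steinhaus (g := T) fun a => h a (hsum a)
  refine ⟨C, fun j i => ?_⟩
  -- Evaluation at the unit vectors of `ℓ¹` recovers the coefficients.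
  have h1 := (T j).le_of_opNorm_le (hC j) (lp.single 1 i (1 : ℂ))
  have h2 : T j (lp.single 1 i (1 : ℂ)) = b j i := by
    change ∑' k, (lp.single 1 i (1 : ℂ) : lp (fun _ : ℕ => ℂ) 1) k * b j k = _
    rw [tsum_eq_single i]
    · simp
    · intro k hk
      simp [hk]
  rwa [h2, lp.norm_single (by simp), norm_one, mul_one] at h1

/-- Differentiating a character `k` times costs at most `‖ξ i‖ ^ k`, so the hypothesis is a
Weierstrass majorant for every order. -/
theorem contDiff_tsum_character {d : ℕ} {c : ℕ → ℂ} {ξ : ℕ → Euc d}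
    (h : ∀ k : ℕ, Summable fun i => ‖c i‖ * ‖ξ i‖ ^ k) :
    ContDiff ℝ ∞ fun x => ∑' i, c i * character (ξ i) x := by
  refine contDiff_tsum (v := fun k i => ‖c i‖ * ‖ξ i‖ ^ k)
    (fun i => contDiff_const.mul (contDiff_character _)) (fun k _ => h k) fun k i x _ => ?_
  have h1 : iteratedFDeriv ℝ k (fun x => c i * character (ξ i) x) x =
      c i • iteratedFDeriv ℝ k (character (ξ i)) x := by
    change iteratedFDeriv ℝ k (c i • character (ξ i)) x = _
    exact iteratedFDeriv_const_smul_apply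
      (((contDiff_character (ξ i)).of_le (by exact_mod_cast le_top)).contDiffAt)
  rw [h1, norm_smul]
  gcongr
  exact norm_iteratedFDeriv_character_le _ _ _

theorem integral_mul_tsum_character {d : ℕ} {u : Euc d → ℂ} (hu : Continuous u)
    (hc : HasCompactSupport u) {c : ℕ → ℂ} (ξ : ℕ → Euc d) (h : Summable fun i => ‖c i‖) :
    ∫ x, u x * ∑' i, c i * character (ξ i) x = ∑' i, c i * ∫ x, u x * character (ξ i) x := by
  have hint : Integrable u := hu.integrable_of_hasCompactSupport hc
  have hnorm : ∀ i x, ‖c i * (u x * character (ξ i) x)‖ = ‖c i‖ * ‖u x‖ := fun i x => by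
    rw [norm_mul, norm_mul, norm_character, mul_one]
  have hcont : ∀ i, Continuous fun x => c i * (u x * character (ξ i) x) := fun i =>
    continuous_const.mul (hu.mul (continuous_character _))
  have hint' : ∀ i, Integrable fun x => c i * (u x * character (ξ i) x) := fun i =>
    (hint.norm.const_mul ‖c i‖).mono' (hcont i).aestronglyMeasurable
      (ae_of_all _ fun x => (hnorm i x).le)
  calc ∫ x, u x * ∑' i, c i * character (ξ i) x
      = ∫ x, ∑' i, c i * (u x * character (ξ i) x) := by
        refine integral_congr_ae (ae_of_all _ fun x => ?_)
        simp only
        rw [← tsum_mul_left]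
        exact tsum_congr fun i => by ring
    _ = ∑' i, ∫ x, c i * (u x * character (ξ i) x) := by
        refine (integral_tsum_of_summable_integral_norm hint' ?_).symm
        simp only [hnorm, integral_const_mul]
        exact h.mul_right _
    _ = ∑' i, c i * ∫ x, u x * character (ξ i) x := by
        simp only [integral_const_mul]

theorem hasCompactSupport_net {d : ℕ} {u : moderateNets d} (hu : HasCompactSupportNet u)
    (ε : Index) : HasCompactSupport (u.1 ε) := by
  obtain ⟨K, hK, h⟩ := hu
  exact hK.of_isClosed_subset (isClosed_tsupport _) (h ε)

theorem norm_integral_mul_character_le {d : ℕ} (u : Euc d → ℂ) (ξ : Euc d) :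
    ‖∫ x, u x * character ξ x‖ ≤ ∫ x, ‖u x‖ := by
  refine (norm_integral_le_integral_norm _).trans_eq ?_
  simp [norm_character]

theorem summable_mul_of_eventually_le {a w : ℕ → ℝ} (ha : Summable a) (ha0 : ∀ i, 0 ≤ a i)
    (hw0 : ∀ i, 0 ≤ w i) (hw : ∀ᶠ i in atTop, w i ≤ 1) : Summable fun i => a i * w i := by
  refine ha.of_norm_bounded_eventually_nat ?_
  filter_upwards [hw] with i hi
  rw [Real.norm_of_nonneg (mul_nonneg (ha0 i) (hw0 i))]
  exact mul_le_of_le_one_right (ha0 i) hi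

theorem fourier_eq_zero_of_forall_test {d : ℕ} {f : Gc d}
    (hf : ∀ φ : 𝓓((⊤ : TopologicalSpace.Opens (Euc d)), ℂ), pairing f (GenFun.ofTest φ) = 0)
    {ξ : GenPoint (Euc d)} (hξ : ξ.IsSlowScale) : fourier f ξ = 0 := by
  obtain ⟨u, huf, hu⟩ := f.2
  obtain ⟨x, rfl, hx⟩ := hξ
  rw [slowScale_iff] at hx
  rw [fourier_mk_eq_zero_iff hu huf]
  intro m
  by_contra hcon
  have hfreq : ∃ᶠ ε in small, ¬ ‖∫ y, u.1 ε y * character (x.1 ε) y‖ ≤ (ε : ℝ) ^ m :=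
    not_eventually.1 hcon
  obtain ⟨e, he, hbad⟩ := exists_seq_forall_of_frequently hfreq
  have hp : ∀ i, 0 < (e i : ℝ) := fun i => (e i).2.1
  obtain ⟨K, hK, hKu⟩ := id hu
  obtain ⟨χ, hχ, hχc, hχ1⟩ := exists_smooth_cutoff hK
  have hw : ∀ k : ℕ, ∀ᶠ i in atTop, (e i : ℝ) * ‖x.1 (e i)‖ ^ k ≤ 1 := fun k => by
    filter_upwards [he.eventually (hx k)] with i hi
    calc (e i : ℝ) * ‖x.1 (e i)‖ ^ k ≤ (e i : ℝ) * (e i : ℝ)⁻¹ := by gcongr; exact (hp i).le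
      _ = 1 := mul_inv_cancel₀ (hp i).ne'
  set U : ℕ → ℕ → ℂ := fun j i => ∫ y, u.1 (e j) y * character (x.1 (e i)) y with hU
  -- Of the two extra powers, one is cancelled on the diagonal by the weight `e i`, the other
  -- absorbs the Banach–Steinhaus constant.
  let b : ℕ → ℕ → ℂ := fun j i => ((e j : ℝ) : ℂ)⁻¹ ^ (m + 2) * ((e i : ℝ) * U j i)
  have hb : ∀ j, ∃ C : ℝ, ∀ i, ‖b j i‖ ≤ C := fun j => by
    refine ⟨(e j : ℝ)⁻¹ ^ (m + 2) * ∫ y, ‖u.1 (e j) y‖, fun i => ?_⟩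
    have h1 : ‖U j i‖ ≤ ∫ y, ‖u.1 (e j) y‖ := norm_integral_mul_character_le _ _
    have h2 : ‖b j i‖ = (e j : ℝ)⁻¹ ^ (m + 2) * ((e i : ℝ) * ‖U j i‖) := by
      simp only [b, norm_mul, norm_pow, norm_inv, Complex.norm_real, Real.norm_of_nonneg (hp _).le]
    rw [h2]
    have h3 := hp j
    gcongr
    exact (mul_le_of_le_one_left (norm_nonneg _) (e i).2.2).trans h1
  have hbound := bounded_of_forall_summable hb fun a ha => by
    -- The weight `e i` offsets `‖ξ‖ ^ k` for every `k`, though only from an index depending on `k`;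
    -- that is enough for summability.
    let c : ℕ → ℂ := fun i => a i * (e i : ℝ)
    have hcn : ∀ i k, ‖c i‖ * ‖x.1 (e i)‖ ^ k = ‖a i‖ * ((e i : ℝ) * ‖x.1 (e i)‖ ^ k) :=
      fun i k => by
        simp only [c, norm_mul, Complex.norm_real, Real.norm_of_nonneg (hp _).le, mul_assoc]
    have hc : ∀ k : ℕ, Summable fun i => ‖c i‖ * ‖x.1 (e i)‖ ^ k := fun k => by
      simp only [hcn]
      exact summable_mul_of_eventually_le ha (fun i => norm_nonneg _)
        (fun i => mul_nonneg (hp i).le (by positivity)) (hw k)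
    let φ : 𝓓((⊤ : TopologicalSpace.Opens (Euc d)), ℂ) :=
      ⟨fun y => χ y * ∑' i, c i * character (x.1 (e i)) y,
        hχ.mul (contDiff_tsum_character hc), hχc.mul_right, fun _ _ => trivial⟩
    have hφ := (pairing_mk_eq_zero_iff hu huf).1 (hf φ) (m + 2)
    have hval : ∀ j, ∑' i, a i * b j i =
        ((e j : ℝ) : ℂ)⁻¹ ^ (m + 2) * ∫ y, u.1 (e j) y * φ y := fun j => by
      have h1 : ∀ y, u.1 (e j) y * φ y = u.1 (e j) y * ∑' i, c i * character (x.1 (e i)) y :=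
        fun y => by
          change u.1 (e j) y * (χ y * _) = _
          by_cases hy : y ∈ K
          · rw [hχ1 y hy, one_mul]
          · rw [eq_zero_of_tsupport_subset (hKu (e j)) y hy, zero_mul, zero_mul]
      simp only [h1]
      rw [integral_mul_tsum_character (u.2.1 _).continuous (hasCompactSupport_net hu _) _
        (by simpa using hc 0), ← tsum_mul_left]
      refine tsum_congr fun i => ?_
      simp only [b, c, hU]
      ring
    have hev : ∀ᶠ j in atTop, ‖∑' i, a i * b j i‖ ≤ 1 := by
      filter_upwards [he.eventually hφ] with j hj
      rw [hval, norm_mul, norm_pow, norm_inv, Complex.norm_real, Real.norm_of_nonneg (hp j).le]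
      have h3 := hp j
      calc (e j : ℝ)⁻¹ ^ (m + 2) * ‖∫ y, u.1 (e j) y * φ y‖
          ≤ (e j : ℝ)⁻¹ ^ (m + 2) * (e j : ℝ) ^ (m + 2) := by gcongr
        _ = 1 := by rw [← mul_pow, inv_mul_cancel₀ h3.ne', one_pow]
    obtain ⟨J, hJ⟩ := eventually_atTop.1 hev
    refine ⟨1 + ∑ j ∈ Finset.range J, ‖∑' i, a i * b j i‖, fun j => ?_⟩
    have hnn : ∀ k ∈ Finset.range J, 0 ≤ ‖∑' i, a i * b k i‖ := fun _ _ => norm_nonneg _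
    rcases le_or_gt J j with hj | hj
    · exact (hJ j hj).trans (le_add_of_nonneg_right (Finset.sum_nonneg hnn))
    · exact (Finset.single_le_sum hnn (Finset.mem_range.2 hj)).trans
        (le_add_of_nonneg_left zero_le_one)
  obtain ⟨C, hC⟩ := hbound
  obtain ⟨j, hj⟩ := (he.eventually (eventually_const_le C)).exists
  -- With `i = j` and `C ≤ (e j)⁻¹`, the coefficient bound becomes the very estimate that fails
  -- along the sequence.
  refine hbad j ?_
  have h3 := hp j
  have h4 := (hC j j).trans hj
  simp only [b, norm_mul, norm_pow, norm_inv, Complex.norm_real, Real.norm_of_nonneg h3.le] at h4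
  have h5 : (e j : ℝ)⁻¹ ^ (m + 2) * ((e j : ℝ) * ‖U j j‖) =
      (e j : ℝ)⁻¹ * ((e j : ℝ) ^ m)⁻¹ * ‖U j j‖ := by
    rw [pow_add, inv_pow, inv_pow]
    field_simp
  rw [h5, mul_assoc] at h4
  have h6 := le_of_mul_le_mul_left (h4.trans_eq (mul_one _).symm) (inv_pos.2 h3)
  rwa [inv_mul_le_iff₀ (by positivity), mul_one] at h6

/-! ### Fourier decay and Parseval -/

/-- `𝓕` has `2π` in its exponent and `character` does not; this is the source of the constant `c =
2π` in the final estimate. -/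
theorem fourier_eq_integral_character {d : ℕ} (u : Euc d → ℂ) (w : Euc d) :
    𝓕 u w = ∫ x, u x * character ((2 * Real.pi) • w) x := by
  rw [Real.fourier_eq']
  refine integral_congr_ae (ae_of_all _ fun x => ?_)
  simp only [character, smul_eq_mul]
  rw [mul_comm, inner_smul_left, real_inner_comm]
  congr 2
  simp only [conj_trivial]
  push_cast
  ring

/-- The Fourier transform of a smooth function supported in a compact set decays rapidly, with
constants that depend only on the bounds of its derivatives. -/
theorem exists_fourier_decay {d : ℕ} {L : Set (Euc d)} (hL : IsCompact L) (n : ℕ) :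
    ∃ C : ℝ, 0 ≤ C ∧ ∀ (ψ : Euc d → ℂ) (B : ℝ), ContDiff ℝ ∞ ψ → tsupport ψ ⊆ L →
      (∀ k ≤ n, ∀ x ∈ L, ‖iteratedFDeriv ℝ k ψ x‖ ≤ B) → 0 ≤ B →
        ∀ w, (1 + ‖w‖) ^ n * ‖𝓕 ψ w‖ ≤ C * B := by
  have hpow : ∀ j ≤ n, ∃ C : ℝ, 0 ≤ C ∧ ∀ (ψ : Euc d → ℂ) (B : ℝ), ContDiff ℝ ∞ ψ →
      tsupport ψ ⊆ L → (∀ k ≤ n, ∀ x ∈ L, ‖iteratedFDeriv ℝ k ψ x‖ ≤ B) → 0 ≤ B →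
        ∀ w, ‖w‖ ^ j * ‖𝓕 ψ w‖ ≤ C * B := by
    intro j hj
    refine ⟨2 ^ j * ((j + 1 : ℕ) * volume.real L), by positivity, fun ψ B hψ hψL hB hB0 w => ?_⟩
    have hts : ∀ k, tsupport (iteratedFDeriv ℝ k ψ) ⊆ L := fun k =>
      (tsupport_iteratedFDeriv_subset (𝕜 := ℝ) (f := ψ) k).trans hψL
    have hcont : ∀ k : ℕ, Continuous (iteratedFDeriv ℝ k ψ) := fun k =>
      hψ.continuous_iteratedFDeriv (by exact_mod_cast le_top)
    have hint : ∀ i k : ℕ, Integrable fun v => ‖v‖ ^ i * ‖iteratedFDeriv ℝ k ψ v‖ := fun i k =>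
      ((continuous_norm.pow i).mul (hcont k).norm).integrable_of_hasCompactSupport
        (HasCompactSupport.norm
          (hL.of_isClosed_subset (isClosed_tsupport _) (hts k))).mul_left
    -- With no derivative on the Fourier side, only the `L¹` norms of the derivatives of `ψ` of
    -- order at most `j` enter, without polynomial weights.
    have h := Real.pow_mul_norm_iteratedFDeriv_fourier_le (K := 0) (N := ⊤) (f := ψ) hψ
      (fun i k _ _ => hint i k) (k := 0) (n := j) le_rfl le_top w
    rw [norm_iteratedFDeriv_zero] at h
    refine h.trans ?_
    have hk : ∀ p ∈ Finset.range (0 + 1) ×ˢ Finset.range (j + 1),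
        ∫ v, ‖v‖ ^ p.1 * ‖iteratedFDeriv ℝ p.2 ψ v‖ ≤ volume.real L * B := by
      rintro ⟨i, k⟩ hp
      simp only [zero_add, Finset.mem_product, Finset.mem_range, Nat.lt_one_iff] at hp
      obtain ⟨rfl, hk⟩ := hp
      simp only [pow_zero, one_mul]
      rw [← setIntegral_eq_integral_of_forall_compl_eq_zero (s := L) fun x hx => by
        rw [image_eq_zero_of_notMem_tsupport fun hx' => hx (hts k hx'), norm_zero], mul_comm]
      refine (Real.le_norm_self _).trans
        (norm_setIntegral_le_of_norm_le_const hL.measure_lt_top fun x hx => ?_)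
      rw [norm_norm]
      exact hB k (by omega) x hx
    have hs := Finset.sum_le_card_nsmul _ _ _ hk
    rw [Finset.card_product, Finset.card_range, Finset.card_range, nsmul_eq_mul] at hs
    calc _ ≤ (2 * Real.pi) ^ 0 * (2 * ((0 : ℕ) : ℝ) + 2) ^ j *
          (((0 + 1) * (j + 1) : ℕ) * (volume.real L * B)) := by gcongr
      _ = _ := by push_cast; ring
  -- The exponents `0` and `n` suffice, since `(1 + r)^n ≤ 2^n (1 + r^n)`.
  obtain ⟨C₀, hC₀, h₀⟩ := hpow 0 (Nat.zero_le n)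
  obtain ⟨C, hC, h⟩ := hpow n le_rfl
  refine ⟨2 ^ n * (C₀ + C), by positivity, fun ψ B hψ hψL hB hB0 w => ?_⟩
  have h1 := h₀ ψ B hψ hψL hB hB0 w
  have h2 := h ψ B hψ hψL hB hB0 w
  rw [pow_zero] at h1
  have h3 : (1 + ‖w‖) ^ n ≤ 2 ^ n * (1 + ‖w‖ ^ n) := by
    rcases le_total ‖w‖ 1 with hw | hw
    · calc (1 + ‖w‖) ^ n ≤ 2 ^ n := by gcongr; linarith
        _ ≤ 2 ^ n * (1 + ‖w‖ ^ n) := le_mul_of_one_le_right (by positivity) (by simp)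
    · calc (1 + ‖w‖) ^ n ≤ (2 * ‖w‖) ^ n := by gcongr; linarith
        _ = 2 ^ n * ‖w‖ ^ n := mul_pow _ _ _
        _ ≤ 2 ^ n * (1 + ‖w‖ ^ n) := by gcongr; linarith
  calc (1 + ‖w‖) ^ n * ‖𝓕 ψ w‖ ≤ 2 ^ n * (1 + ‖w‖ ^ n) * ‖𝓕 ψ w‖ := by gcongr
    _ = 2 ^ n * (1 * ‖𝓕 ψ w‖ + ‖w‖ ^ n * ‖𝓕 ψ w‖) := by ring
    _ ≤ 2 ^ n * (C₀ * B + C * B) := by gcongr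
    _ = 2 ^ n * (C₀ + C) * B := by ring

/-- Parseval's identity, as an estimate of `∫ u ψ`. -/
theorem norm_integral_mul_le_of_fourier_le {d : ℕ} {u ψ : Euc d → ℂ} (hu : Integrable u)
    (hψ : ContDiff ℝ ∞ ψ) (hψc : HasCompactSupport ψ) {δ : ℝ}
    (h : ∀ w, ‖𝓕 u w‖ * ‖𝓕 ψ (-w)‖ ≤ δ * (1 + ‖w‖) ^ (-((d : ℝ) + 1))) :
    ‖∫ x, u x * ψ x‖ ≤ δ * ∫ w : Euc d, (1 + ‖w‖) ^ (-((d : ℝ) + 1)) := by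
  let Ψ : 𝓢(Euc d, ℂ) := hψc.toSchwartzMap hψ
  let g : 𝓢(Euc d, ℂ) := 𝓕⁻ Ψ
  have hg : 𝓕 (g : Euc d → ℂ) = ψ := by
    rw [← SchwartzMap.fourier_coe]
    simp only [g, FourierTransform.fourier_fourierInv_eq]
    rfl
  have hg' : ∀ w, g w = 𝓕 ψ (-w) := fun w => by
    rw [← Real.fourierInv_eq_fourier_neg]
    change (𝓕⁻ Ψ : 𝓢(Euc d, ℂ)) w = _
    rw [SchwartzMap.fourierInv_coe]
    rfl
  -- As `ψ = 𝓕 g` with `g` Schwartz, the transform moves onto `u`, for which integrability is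
  -- enough.
  have hflip : ∫ x, u x * ψ x = ∫ w, 𝓕 u w * g w := by
    have := VectorFourier.integral_fourierIntegral_smul_eq_flip (L := innerₗ (Euc d))
      Real.continuous_fourierChar continuous_inner hu (g.integrable (μ := volume))
    rw [flip_innerₗ] at this
    rw [← hg]
    exact this.symm
  rw [hflip, ← integral_const_mul]
  refine norm_integral_le_of_norm_le
    ((integrable_one_add_norm (r := (d : ℝ) + 1) (by simp)).const_mul δ) (ae_of_all _ fun w => ?_)
  rw [norm_mul, hg']
  exact h w

/-! ### From slow scale points to regular functions: 3 → 2 -/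

/-- The Leibniz constants depend on `k`, but one factor `ε⁻¹` absorbs each of them for small `ε`.
The exponent thus stays independent of `k`, which is what regularity requires. -/
theorem exists_uniform_bound_iteratedFDeriv_mul {d : ℕ} {χ : Euc d → ℂ} (hχ : ContDiff ℝ ∞ χ)
    {v : Index → Euc d → ℂ} (hv : ∀ ε, ContDiff ℝ ∞ (v ε)) {L : Set (Euc d)} (hL : IsCompact L)
    {N : ℕ} (h : ∀ k : ℕ, ∀ᶠ ε in small, ∀ x ∈ L,
      ‖iteratedFDeriv ℝ k (v ε) x‖ ≤ ((ε : ℝ) ^ N)⁻¹) (k : ℕ) :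
    ∀ᶠ ε in small, ∀ x ∈ L,
      ‖iteratedFDeriv ℝ k (fun y => χ y * v ε y) x‖ ≤ ((ε : ℝ) ^ (N + 1))⁻¹ := by
  have hC : ∀ i : ℕ, ∃ C : ℝ, ∀ x ∈ L, ‖iteratedFDeriv ℝ i χ x‖ ≤ C := fun i =>
    hL.exists_bound_of_continuousOn
      (hχ.continuous_iteratedFDeriv (m := i) (by exact_mod_cast le_top)).continuousOn
  choose C hC using hC
  have hall : ∀ᶠ ε in small, ∀ i ∈ Finset.range (k + 1), ∀ x ∈ L,
      ‖iteratedFDeriv ℝ (k - i) (v ε) x‖ ≤ ((ε : ℝ) ^ N)⁻¹ :=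
    (Finset.eventually_all _).2 fun i _ => h (k - i)
  filter_upwards [hall, eventually_const_le (∑ i ∈ Finset.range (k + 1), (k.choose i : ℝ) * C i)]
    with ε h1 h2 x hx
  have hp : 0 < (ε : ℝ) := ε.2.1
  calc ‖iteratedFDeriv ℝ k (fun y => χ y * v ε y) x‖
      ≤ ∑ i ∈ Finset.range (k + 1), (k.choose i : ℝ) * ‖iteratedFDeriv ℝ i χ x‖ *
          ‖iteratedFDeriv ℝ (k - i) (v ε) x‖ :=
        norm_iteratedFDeriv_mul_le hχ (hv ε) x (by exact_mod_cast le_top)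
    _ ≤ ∑ i ∈ Finset.range (k + 1), (k.choose i : ℝ) * C i * ((ε : ℝ) ^ N)⁻¹ := by
        refine Finset.sum_le_sum fun i hi => ?_
        have h3 := hC i x hx
        have h4 := h1 i hi x hx
        have h5 : 0 ≤ C i := (norm_nonneg _).trans h3
        gcongr
    _ = (∑ i ∈ Finset.range (k + 1), (k.choose i : ℝ) * C i) * ((ε : ℝ) ^ N)⁻¹ :=
        (Finset.sum_mul _ _ _).symm
    _ ≤ (ε : ℝ)⁻¹ * ((ε : ℝ) ^ N)⁻¹ := by gcongr
    _ = ((ε : ℝ) ^ (N + 1))⁻¹ := by rw [pow_succ, mul_inv, mul_comm]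

theorem exists_fourier_le_of_slowScale {d : ℕ} {f : Gc d}
    (hf : ∀ ξ : GenPoint (Euc d), ξ.IsSlowScale → fourier f ξ = 0) {u : moderateNets d}
    (hu : HasCompactSupportNet u) (huf : GenFun.mk u = f.1) (m : ℕ) :
    ∃ n : ℕ, ∀ᶠ ε : Index in small, ∀ ξ : Euc d, ‖ξ‖ ^ n ≤ (ε : ℝ)⁻¹ →
      ‖∫ x, u.1 ε x * character ξ x‖ ≤ (ε : ℝ) ^ m := by
  refine exists_uniform_of_forall_slowScale (V := Euc d)
    (P := fun ε ξ => ‖∫ x, u.1 ε x * character ξ x‖ ≤ (ε : ℝ) ^ m) fun x hx => ?_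
  exact (fourier_mk_eq_zero_iff hu huf ⟨x, moderatePoints_of_slowScale hx⟩).1
    (hf _ ⟨_, rfl, slowScale_iff.2 hx⟩) m

/-- Characters are unimodular, so the bound is uniform over all frequencies, including those far
outside the slow scale range. -/
theorem exists_moderate_fourier {d : ℕ} {u : moderateNets d} (hu : HasCompactSupportNet u) :
    ∃ N : ℕ, ∀ᶠ ε in small, ∀ ξ : Euc d,
      ‖∫ x, u.1 ε x * character ξ x‖ ≤ ((ε : ℝ) ^ N)⁻¹ := by
  obtain ⟨K, hK, hKu⟩ := hu
  obtain ⟨N, hN⟩ := moderateOn_net u hK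
  refine ⟨N + 1, ?_⟩
  filter_upwards [hN, eventually_const_le (volume.real K)] with ε h1 h2 ξ
  have hp : 0 < (ε : ℝ) := ε.2.1
  calc ‖∫ x, u.1 ε x * character ξ x‖ ≤ volume.real K * ((ε : ℝ) ^ N)⁻¹ :=
        norm_integral_le_of_compact hK
          (fun x hx => by rw [eq_zero_of_tsupport_subset (hKu ε) x hx, zero_mul])
          (fun x hx => by simpa [norm_character] using h1 x hx)
    _ ≤ (ε : ℝ)⁻¹ * ((ε : ℝ) ^ N)⁻¹ := by gcongr
    _ = ((ε : ℝ) ^ (N + 1))⁻¹ := by rw [pow_succ, mul_inv, mul_comm]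

/-- A product of a function that is small near the origin and moderate elsewhere with a rapidly
decreasing function is small: `r = 1 + ‖w‖` and `A`, `B` are the norms of the two factors. -/
theorem mul_le_of_small_or_large {e A B r c : ℝ} {m N₁ N₂ n s : ℕ} (he : 0 < e)
    (hB : 0 ≤ B) (hr : 1 ≤ r) (hA₁ : A ≤ (e ^ N₁)⁻¹)
    (hA₂ : (c * r) ^ n ≤ e⁻¹ → A ≤ e ^ (m + N₂))
    (hB₁ : r ^ s * B ≤ (e ^ N₂)⁻¹)
    (hB₂ : r ^ (n * (N₁ + N₂ + m + 1) + s) * B ≤ (e ^ N₂)⁻¹)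
    (hce : c ^ (n * (N₁ + N₂ + m + 1)) ≤ e⁻¹) :
    A * (r ^ s * B) ≤ e ^ m := by
  have hr0 : 0 < r := by linarith
  rcases le_or_gt ((c * r) ^ n) e⁻¹ with h | h
  · calc A * (r ^ s * B) ≤ e ^ (m + N₂) * (e ^ N₂)⁻¹ :=
          mul_le_mul (hA₂ h) hB₁ (by positivity) (by positivity)
      _ = e ^ m := by rw [pow_add]; field_simp
  -- Here `c r` exceeds `e^{-1/n}`, so `nq` extra powers of `r` gain `e^{-q}`; the `+ 1` in `q` pays
  -- for `c ^ (n q)`, and the rest beats both moderate bounds and leaves `e ^ m`.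
  · set q := N₁ + N₂ + m + 1 with hq
    have h1 : (e ^ q)⁻¹ ≤ e⁻¹ * r ^ (n * q) := by
      calc (e ^ q)⁻¹ = (e⁻¹) ^ q := (inv_pow _ _).symm
        _ ≤ ((c * r) ^ n) ^ q := by gcongr
        _ = c ^ (n * q) * r ^ (n * q) := by rw [← pow_mul, mul_pow]
        _ ≤ e⁻¹ * r ^ (n * q) := by gcongr
    have h2 : 1 ≤ e ^ (N₁ + N₂ + m) * r ^ (n * q) := by
      rw [inv_le_iff_one_le_mul₀' (by positivity)] at h1
      refine h1.trans_eq ?_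
      rw [hq, pow_succ]
      field_simp
    calc A * (r ^ s * B) ≤ (e ^ N₁)⁻¹ * (r ^ s * B) := by gcongr
      _ ≤ (e ^ N₁)⁻¹ * ((e ^ (N₁ + N₂ + m) * r ^ (n * q)) * (r ^ s * B)) := by
          exact mul_le_mul_of_nonneg_left (le_mul_of_one_le_left (by positivity) h2)
            (by positivity)
      _ = (e ^ N₁)⁻¹ * e ^ (N₁ + N₂ + m) * (r ^ (n * q + s) * B) := by rw [pow_add r]; ring
      _ ≤ (e ^ N₁)⁻¹ * e ^ (N₁ + N₂ + m) * (e ^ N₂)⁻¹ := by gcongr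
      _ = e ^ m := by rw [pow_add, pow_add]; field_simp

theorem pairing_eq_zero_of_forall_slowScale {d : ℕ} {f : Gc d}
    (hf : ∀ ξ : GenPoint (Euc d), ξ.IsSlowScale → fourier f ξ = 0) {φ : GenFun d}
    (hφ : φ ∈ GInf d) : pairing f φ = 0 := by
  obtain ⟨u, huf, hu⟩ := f.2
  obtain ⟨v, rfl, hv⟩ := hφ
  rw [pairing_mk_eq_zero_iff hu huf]
  intro m
  obtain ⟨K, hK, hKu⟩ := id hu
  obtain ⟨χ, hχ, hχc, hχ1⟩ := exists_smooth_cutoff hK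
  have hL : IsCompact (tsupport χ) := hχc
  obtain ⟨N, hN⟩ := hv _ hL
  obtain ⟨N₁, hN₁⟩ := exists_moderate_fourier hu
  -- One power is lost in multiplying by the cut-off, one to the constant of the Fourier decay.
  let N₂ := N + 2
  -- `N₂` compensates the growth of the other factor; the `1` absorbs the integral `J`.
  obtain ⟨n, hn⟩ := exists_fourier_le_of_slowScale hf hu huf (m + 1 + N₂)
  have hψ : ∀ ε, ContDiff ℝ ∞ fun y => χ y * v.1 ε y := fun ε => hχ.mul (v.2.1 ε)
  have hψL : ∀ ε, tsupport (fun y => χ y * v.1 ε y) ⊆ tsupport χ := fun ε =>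
    tsupport_mul_subset_left (f := χ) (g := v.1 ε)
  have hdecay : ∀ k : ℕ, ∀ᶠ ε in small, ∀ w,
      (1 + ‖w‖) ^ k * ‖𝓕 (fun y => χ y * v.1 ε y) w‖ ≤ ((ε : ℝ) ^ N₂)⁻¹ := fun k => by
    obtain ⟨C, hC, hdec⟩ := exists_fourier_decay hL k
    have hall : ∀ᶠ ε in small, ∀ i ∈ Finset.range (k + 1), ∀ x ∈ tsupport χ,
        ‖iteratedFDeriv ℝ i (fun y => χ y * v.1 ε y) x‖ ≤ ((ε : ℝ) ^ (N + 1))⁻¹ :=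
      (Finset.eventually_all _).2 fun i _ =>
        exists_uniform_bound_iteratedFDeriv_mul hχ v.2.1 hL hN i
    filter_upwards [hall, eventually_const_le C] with ε h1 h2 w
    have hp : 0 < (ε : ℝ) := ε.2.1
    calc _ ≤ C * ((ε : ℝ) ^ (N + 1))⁻¹ :=
          hdec _ _ (hψ ε) (hψL ε)
            (fun i hi => h1 i (Finset.mem_range.2 (by omega))) (by positivity) w
      _ ≤ (ε : ℝ)⁻¹ * ((ε : ℝ) ^ (N + 1))⁻¹ := by gcongr
      _ = ((ε : ℝ) ^ N₂)⁻¹ := by rw [pow_succ _ (N + 1), mul_inv, mul_comm]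
  set J : ℝ := ∫ w : Euc d, (1 + ‖w‖) ^ (-((d : ℝ) + 1)) with hJ
  filter_upwards [hN₁, hn, hdecay (d + 1), hdecay (n * (N₁ + N₂ + (m + 1) + 1) + (d + 1)),
    eventually_const_le ((2 * Real.pi) ^ (n * (N₁ + N₂ + (m + 1) + 1))), eventually_const_le J]
    with ε h1 h2 h3 h4 h5 h6
  have hp : 0 < (ε : ℝ) := ε.2.1
  -- The compact support of `u` allows the cut-off to be inserted, so membership of `φ` in `GInf` is
  -- enough.
  have hcut : ∀ x, u.1 ε x * v.1 ε x = u.1 ε x * (χ x * v.1 ε x) := fun x => by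
    by_cases hx : x ∈ K
    · rw [hχ1 x hx, one_mul]
    · rw [eq_zero_of_tsupport_subset (hKu ε) x hx, zero_mul, zero_mul]
  simp only [hcut]
  have hmain : ∀ w, ‖𝓕 (u.1 ε) w‖ * ‖𝓕 (fun y => χ y * v.1 ε y) (-w)‖ ≤
      (ε : ℝ) ^ (m + 1) * (1 + ‖w‖) ^ (-((d : ℝ) + 1)) := fun w => by
    have hr : 0 < 1 + ‖w‖ := by positivity
    -- The choice `s = d + 1` leaves an integrable weight on `ℝ^d`.
    have hkey := mul_le_of_small_or_large (e := ε) (A := ‖𝓕 (u.1 ε) w‖)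
      (B := ‖𝓕 (fun y => χ y * v.1 ε y) (-w)‖) (r := 1 + ‖w‖) (c := 2 * Real.pi)
      (m := m + 1) (N₁ := N₁) (N₂ := N₂) (n := n) (s := d + 1) hp (norm_nonneg _)
      (by simp) (by rw [fourier_eq_integral_character]; exact h1 _)
      (fun hsmall => by
        rw [fourier_eq_integral_character]
        refine h2 _ (le_trans ?_ hsmall)
        rw [norm_smul, Real.norm_of_nonneg (by positivity)]
        gcongr
        linarith)
      (by simpa using h3 (-w)) (by simpa using h4 (-w)) h5
    have hrp : (1 + ‖w‖) ^ (-((d : ℝ) + 1)) = ((1 + ‖w‖) ^ (d + 1))⁻¹ := by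
      rw [Real.rpow_neg hr.le, ← Real.rpow_natCast]
      push_cast
      rfl
    rw [hrp, ← div_eq_mul_inv, le_div_iff₀ (by positivity)]
    calc _ = ‖𝓕 (u.1 ε) w‖ * ((1 + ‖w‖) ^ (d + 1) * ‖𝓕 (fun y => χ y * v.1 ε y) (-w)‖) := by ring
      _ ≤ _ := hkey
  calc ‖∫ x, u.1 ε x * (χ x * v.1 ε x)‖ ≤ (ε : ℝ) ^ (m + 1) * J :=
        norm_integral_mul_le_of_fourier_le (integrable_net u hu ε) (hψ ε) hχc.mul_right hmain
    _ ≤ (ε : ℝ) ^ (m + 1) * (ε : ℝ)⁻¹ := by gcongr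
    _ = (ε : ℝ) ^ m := by rw [pow_succ]; field_simp

/-- Derivatives of a constant net are bounded independently of `ε` on compact sets, so `N = 1`
serves every order. -/
theorem ofTest_mem_GcInf {d : ℕ} (φ : 𝓓((⊤ : TopologicalSpace.Opens (Euc d)), ℂ)) :
    GenFun.ofTest φ ∈ GcInf d := by
  refine ⟨⟨_, rfl, fun K hK => ⟨1, fun k => ?_⟩⟩, _, rfl, tsupport φ, φ.hasCompactSupport,
    fun _ => subset_rfl⟩
  obtain ⟨C, hC⟩ := hK.exists_bound_of_continuousOn
    (φ.contDiff.continuous_iteratedFDeriv (m := k) (by exact_mod_cast le_top)).continuousOn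
  filter_upwards [eventually_const_le C] with ε hε x hx
  rw [pow_one]
  exact (hC x hx).trans hε

end Colombeau

theorem mainTheorem4 (d : ℕ) (f : Colombeau.Gc d) :
    List.TFAE [
      ∀ φ : 𝓓((⊤ : TopologicalSpace.Opens (Colombeau.Euc d)), ℂ),
        Colombeau.pairing f (Colombeau.GenFun.ofTest φ) = 0,
      ∀ φ ∈ Colombeau.GcInf d, Colombeau.pairing f φ = 0,
      ∀ ξ : Colombeau.GenPoint (Colombeau.Euc d), ξ.IsSlowScale → Colombeau.fourier f ξ = 0] := by
  tfae_have 2 → 1 := fun h φ => h _ (Colombeau.ofTest_mem_GcInf φ)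
  tfae_have 1 → 3 := fun h _ hξ => Colombeau.fourier_eq_zero_of_forall_test h hξ
  tfae_have 3 → 2 := fun h _ hφ => Colombeau.pairing_eq_zero_of_forall_slowScale h hφ.1
  tfae_finish
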